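/- Let $V:(0,\infty)\to\mathbb{R}$ be of the form $V(\rho)=\frac{c_2}{\rho^2}+W(\rho)$, where $c_2\ge-\frac14$ is a constant and $W:[0,\infty)\to\mathbb{R}$ is continuous and bounded, such that the limit $C_0:=\lim_{\rho\to\infty}W(\rho)$ exists and $\int_1^\infty (W(\rho)-C_0)^2\,d\rho<\infty$. Write $c_2=m^2-\frac14$ with $m\ge0$. Let $\tilde H_0=-\frac{d^2}{d\rho^2}+\frac{m^2-1/4}{\rho^2}$ be the operator in the complex Hilbert space $L^2(0,\infty)$ with domain $C_0^\infty(0,\infty)$, and let $\overline{\tilde H_0}$ be its closure. Let $\zeta\in C^\infty([0,\infty))$ be real valued with $\zeta(\rho)=1$ for $\rho\le1$ and $\zeta(\rho)=0$ for $\rho\ge2$, and put $\zeta_m(\rho)=\zeta(\rho)\rho^{\frac12+m}$. Let $H_0$ be the extension of $\tilde H_0$ with domain $\mathrm{D}(H_0)=\mathrm{D}(\overline{\tilde H_0})+\mathbb{C}\zeta_m$, on which it acts by the differential expression $-\frac{d^2}{d\rho^2}+\frac{m^2-1/4}{\rho^2}$ in the sense of distributions (that is, $H_0$ is the restriction of $\tilde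 H_0^*$ to this domain). Then (the operator of multiplication by) $W-C_0$ is relatively compact with respect to $H_0$: $\mathrm{D}(H_0)\subseteq\mathrm{D}(W-C_0)$, and for every sequence $(u_n)$ in $\mathrm{D}(H_0)$ for which $(u_n)$ and $(H_0u_n)$ are bounded in $L^2(0,\infty)$, the sequence $((W-C_0)u_n)$ has a subsequence that converges in $L^2(0,\infty)$. Moreover, for every $z$ in the resolvent set of $H_0$, the operator $(W-C_0)(H_0-z)^{-1}$ is compact on $L^2(0,\infty)$. -/

import Mathlib

open MeasureTheory Set Filter Topology
open scoped ContDiff Distributions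

noncomputable section

namespace HalfLine

/-- The complex Hilbert space `L²(0,∞)`. -/
abbrev L2 : Type := Lp ℂ 2 (volume.restrict (Ioi (0 : ℝ)))

/-- The open half-line `(0,∞)` as an open subset of the real line. -/
def halfLine : TopologicalSpace.Opens ℝ := ⟨Ioi 0, isOpen_Ioi⟩

/-- The space `C₀^∞(0,∞)` of complex-valued smooth functions with compact support in `(0,∞)`. -/
abbrev TestFn : Type := 𝓓(halfLine, ℂ)

/-- The differential expression `-d²/dρ² + (m² - 1/4)/ρ²`. -/
def calogeroExpr (m : ℝ) (φ : ℝ → ℂ) (ρ : ℝ) : ℂ :=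
  -deriv (deriv φ) ρ + (((m ^ 2 - 1 / 4) / ρ ^ 2 : ℝ) : ℂ) * φ ρ

theorem TestFn.memLp (φ : TestFn) :
    MemLp (φ : ℝ → ℂ) 2 (volume.restrict (Ioi (0 : ℝ))) :=
  (φ.continuous.memLp_of_hasCompactSupport φ.hasCompactSupport).restrict _

theorem TestFn.zero_notMem_tsupport (φ : TestFn) : (0 : ℝ) ∉ tsupport (φ : ℝ → ℂ) := by
  intro h
  have h0 : (0 : ℝ) ∈ (halfLine : Set ℝ) := φ.tsupport_subset h
  exact lt_irrefl (0 : ℝ) h0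

theorem TestFn.contDiff_deriv (φ : TestFn) : ContDiff ℝ ∞ (deriv (φ : ℝ → ℂ)) :=
  (contDiff_infty_iff_deriv.1 φ.contDiff).2

theorem TestFn.continuous_calogeroExpr (m : ℝ) (φ : TestFn) :
    Continuous (calogeroExpr m φ) := by
  have h1 : Continuous (deriv (deriv (φ : ℝ → ℂ))) :=
    (contDiff_infty_iff_deriv.1 φ.contDiff_deriv).2.continuous
  refine h1.neg.add ?_
  rw [continuous_iff_continuousAt]
  intro x
  by_cases hx : x = 0
  · subst hx
    have h2 : (φ : ℝ → ℂ) =ᶠ[𝓝 0] 0 := notMem_tsupport_iff_eventuallyEq.1 φ.zero_notMem_tsupport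
    have h3 : (fun ρ : ℝ => (((m ^ 2 - 1 / 4) / ρ ^ 2 : ℝ) : ℂ) * φ ρ) =ᶠ[𝓝 0] fun _ => 0 := by
      filter_upwards [h2] with ρ hρ
      rw [hρ]
      simp
    exact continuousAt_const.congr h3.symm
  · have h4 : ContinuousAt (fun ρ : ℝ => (m ^ 2 - 1 / 4) / ρ ^ 2) x :=
      continuousAt_const.div (continuousAt_id.pow 2) (pow_ne_zero 2 hx)
    exact (Complex.continuous_ofReal.continuousAt.comp h4).mul φ.continuous.continuousAt

theorem TestFn.memLp_calogeroExpr (m : ℝ) (φ : TestFn) :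
    MemLp (calogeroExpr m φ) 2 (volume.restrict (Ioi (0 : ℝ))) := by
  have hs : HasCompactSupport (calogeroExpr m φ) :=
    (φ.hasCompactSupport.deriv.deriv.neg).add
      (φ.hasCompactSupport.mul_left (f := fun ρ : ℝ => (((m ^ 2 - 1 / 4) / ρ ^ 2 : ℝ) : ℂ)))
  exact ((φ.continuous_calogeroExpr m).memLp_of_hasCompactSupport hs).restrict _

/-- The inclusion `C₀^∞(0,∞) → L²(0,∞)`. -/
def TestFn.toL2 : TestFn →ₗ[ℂ] L2 where
  toFun φ := φ.memLp.toLp _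
  map_add' φ ψ := MemLp.toLp_add φ.memLp ψ.memLp
  map_smul' c φ := MemLp.toLp_const_smul c φ.memLp

theorem TestFn.toL2_injective : Function.Injective TestFn.toL2 := by
  intro φ ψ h
  have h1 : (φ : ℝ → ℂ) =ᵐ[volume.restrict (Ioi (0 : ℝ))] ψ :=
    (MemLp.toLp_eq_toLp_iff φ.memLp ψ.memLp).1 h
  have h2 : EqOn (φ : ℝ → ℂ) ψ (Ioi 0) :=
    Measure.eqOn_open_of_ae_eq h1 isOpen_Ioi φ.continuous.continuousOn ψ.continuous.continuousOn
  have h3 : ∀ (χ : TestFn) (x : ℝ), x ∉ Ioi (0 : ℝ) → χ x = 0 := fun χ x hx =>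
    image_eq_zero_of_notMem_tsupport fun hx' => hx (χ.tsupport_subset hx')
  ext x
  by_cases hx : x ∈ Ioi (0 : ℝ)
  · exact h2 hx
  · rw [h3 φ x hx, h3 ψ x hx]

/-- The map `φ ↦ -φ'' + (m² - 1/4)/ρ² φ` from `C₀^∞(0,∞)` to `L²(0,∞)`. -/
def TestFn.calogero (m : ℝ) : TestFn →ₗ[ℂ] L2 where
  toFun φ := (φ.memLp_calogeroExpr m).toLp _
  map_add' φ ψ := by
    rw [← MemLp.toLp_add]
    congr 1
    funext ρ
    have d (χ : TestFn) : Differentiable ℝ (χ : ℝ → ℂ) := χ.contDiff.differentiable (by simp)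
    have d' (χ : TestFn) : Differentiable ℝ (deriv (χ : ℝ → ℂ)) :=
      χ.contDiff_deriv.differentiable (by simp)
    have e : deriv ((φ + ψ : TestFn) : ℝ → ℂ) = deriv φ + deriv ψ := by
      funext x
      exact deriv_add (d φ x) (d ψ x)
    have e' : deriv (deriv φ + deriv ψ) ρ = deriv (deriv φ) ρ + deriv (deriv ψ) ρ :=
      deriv_add (d' φ ρ) (d' ψ ρ)
    have e'' : (φ + ψ : TestFn) ρ = φ ρ + ψ ρ := rfl
    simp only [calogeroExpr, Pi.add_apply, e, e', e'']
    ring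
  map_smul' c φ := by
    rw [RingHom.id_apply, ← MemLp.toLp_const_smul]
    congr 1
    funext ρ
    have d : Differentiable ℝ (φ : ℝ → ℂ) := φ.contDiff.differentiable (by simp)
    have d' : Differentiable ℝ (deriv (φ : ℝ → ℂ)) := φ.contDiff_deriv.differentiable (by simp)
    have e : deriv ((c • φ : TestFn) : ℝ → ℂ) = c • deriv φ := by
      funext x
      exact deriv_const_smul c (d x)
    have e' : deriv (c • deriv φ) ρ = c • deriv (deriv φ) ρ := deriv_const_smul c (d' ρ)
    have e'' : (c • φ : TestFn) ρ = c * φ ρ := rfl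
    simp only [calogeroExpr, Pi.smul_apply, e, e', e'', smul_eq_mul]
    ring

/-- The operator `-d²/dρ² + (m² - 1/4)/ρ²` in `L²(0,∞)` with domain `C₀^∞(0,∞)`. -/
def preH₀ (m : ℝ) : L2 →ₗ.[ℂ] L2 where
  domain := LinearMap.range TestFn.toL2
  toFun := (TestFn.calogero m).comp
    (LinearEquiv.ofInjective TestFn.toL2 TestFn.toL2_injective).symm.toLinearMap

theorem preH₀_apply (m : ℝ) (φ : TestFn) :
    preH₀ m ⟨TestFn.toL2 φ, LinearMap.mem_range_self _ φ⟩ = TestFn.calogero m φ := by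
  change TestFn.calogero m ((LinearEquiv.ofInjective TestFn.toL2 TestFn.toL2_injective).symm
    (LinearEquiv.ofInjective TestFn.toL2 TestFn.toL2_injective φ)) = _
  rw [LinearEquiv.symm_apply_apply]

/-- A cutoff: a smooth function on `[0,∞)` equal to `1` for `ρ ≤ 1` and to `0` for `ρ ≥ 2`. -/
structure IsCutoff (ζ : ℝ → ℝ) : Prop where
  smooth : ContDiffOn ℝ ∞ ζ (Ici 0)
  eq_one : ∀ ρ, 0 ≤ ρ → ρ ≤ 1 → ζ ρ = 1
  eq_zero : ∀ ρ, 2 ≤ ρ → ζ ρ = 0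

/-- The function `ζ_m(ρ) = ζ(ρ) ρ^(1/2 + m)`. -/
def zetaFn (m : ℝ) (ζ : ℝ → ℝ) (ρ : ℝ) : ℂ := ((ζ ρ * ρ ^ (1 / 2 + m) : ℝ) : ℂ)

theorem memLp_zetaFn {m : ℝ} (hm : 0 ≤ m) {ζ : ℝ → ℝ} (hζ : IsCutoff ζ) :
    MemLp (zetaFn m ζ) 2 (volume.restrict (Ioi (0 : ℝ))) := by
  have hc : ContinuousOn (zetaFn m ζ) (Ici 0) := by
    refine Complex.continuous_ofReal.comp_continuousOn (hζ.smooth.continuousOn.mul ?_)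
    exact (Real.continuous_rpow_const (by linarith)).continuousOn
  have h1 : MemLp (zetaFn m ζ) 2 (volume.restrict (Icc (0 : ℝ) 2)) := by
    obtain ⟨C, hC⟩ := isCompact_Icc.exists_bound_of_continuousOn 
      (hc.mono (Icc_subset_Ici_self : Icc (0 : ℝ) 2 ⊆ Ici 0))
    refine MemLp.of_bound ((hc.mono Icc_subset_Ici_self).aestronglyMeasurable measurableSet_Icc) C ?_
    exact (ae_restrict_mem measurableSet_Icc).mono hC
  rw [← memLp_indicator_iff_restrict measurableSet_Icc] at h1
  refine (h1.restrict (Ioi 0)).ae_eq ?_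
  filter_upwards [ae_restrict_mem measurableSet_Ioi] with ρ hρ
  by_cases h2 : ρ ≤ 2
  · exact indicator_of_mem (show ρ ∈ Icc (0 : ℝ) 2 from ⟨le_of_lt hρ, h2⟩) _
  · rw [indicator_of_notMem (fun h => h2 h.2), zetaFn, hζ.eq_zero ρ (le_of_not_ge h2)]
    simp

/-- The domain `D(closure of preH₀) + ℂ ζ_m`. -/
def domH₀ (m : ℝ) (hm : 0 ≤ m) (ζ : ℝ → ℝ) (hζ : IsCutoff ζ) : Submodule ℂ L2 :=
  (preH₀ m).closure.domain ⊔ Submodule.span ℂ {(memLp_zetaFn hm hζ).toLp (zetaFn m ζ)}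

/-- The operator `H₀`: the extension of `preH₀` to the domain `domH₀`, on which it acts by the
differential expression `-d²/dρ² + (m² - 1/4)/ρ²` in the sense of distributions, that is, as the
adjoint (maximal operator) of `preH₀`. -/
def H₀ (m : ℝ) (hm : 0 ≤ m) (ζ : ℝ → ℝ) (hζ : IsCutoff ζ) : L2 →ₗ.[ℂ] L2 :=
  (preH₀ m).adjoint.domRestrict (domH₀ m hm ζ hζ)

/-- `preH₀` is densely defined, so that its adjoint is not a default value. -/
theorem dense_preH₀_domain (m : ℝ) : Dense ((preH₀ m).domain : Set L2) := by
  rw [Submodule.dense_iff_topologicalClosure_eq_top, Submodule.topologicalClosure_eq_top_iff,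
    Submodule.eq_bot_iff]
  intro u hu
  have hloc : LocallyIntegrableOn (u : ℝ → ℂ) (Ioi 0) volume := by
    intro x hx
    refine ⟨Ioc (x / 2) (x + 1), mem_nhdsWithin_of_mem_nhds (Ioc_mem_nhds ?_ ?_), ?_⟩
    · have : (0 : ℝ) < x := hx
      linarith
    · linarith
    · have h1 : MemLp (u : ℝ → ℂ) 2 (volume.restrict (Ioc (x / 2) (x + 1))) := by
        refine (Lp.memLp u).mono_measure (Measure.restrict_mono ?_ le_rfl)
        intro y hy
        have : (0 : ℝ) < x := hx
        exact lt_trans (by linarith) hy.1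
      exact h1.integrable (by norm_num)
  have key := isOpen_Ioi.ae_eq_zero_of_integral_contDiff_smul_eq_zero hloc ?_
  · rw [Lp.eq_zero_iff_ae_eq_zero]
    exact (ae_restrict_iff' measurableSet_Ioi).2 key
  · intro g hg hgc hgs
    let φ : TestFn := ⟨fun x => (g x : ℂ), Complex.ofRealCLM.contDiff.comp hg,
      hgc.comp_left (g := fun x : ℝ => (x : ℂ)) Complex.ofReal_zero,
      (tsupport_comp_subset (g := fun x : ℝ => (x : ℂ)) Complex.ofReal_zero g).trans hgs⟩
    have h0 := hu (TestFn.toL2 φ) (LinearMap.mem_range_self _ φ)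
    rw [L2.inner_def] at h0
    rw [← setIntegral_eq_integral_of_forall_compl_eq_zero (s := Ioi (0 : ℝ)), ← h0]
    · refine integral_congr_ae ?_
      filter_upwards [φ.memLp.coeFn_toLp] with x hx
      have hx' : (TestFn.toL2 φ : ℝ → ℂ) x = (g x : ℂ) := hx
      rw [hx', RCLike.inner_apply, Complex.conj_ofReal, mul_comm]
      simp
    · intro x hx
      rw [image_eq_zero_of_notMem_tsupport fun h => hx (hgs h), zero_smul]

theorem deriv_conj (f : ℝ → ℂ) (x : ℝ) :
    deriv (fun y => starRingEnd ℂ (f y)) x = starRingEnd ℂ (deriv f x) :=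
  deriv.star (f := f) (x := x)

/-- Green's formula against a function that is smooth on `(0,∞)`. -/
theorem integral_green (m : ℝ) {F : ℝ → ℂ} (hF : ContDiffOn ℝ ∞ F (Ioi 0)) (φ : TestFn) :
    ∫ ρ in Ioi (0 : ℝ), calogeroExpr m F ρ * φ ρ = ∫ ρ in Ioi (0 : ℝ), F ρ * calogeroExpr m φ ρ := by
  have hF1 : ContDiffOn ℝ ∞ (deriv F) (Ioi 0) :=
    ((contDiffOn_infty_iff_deriv_of_isOpen isOpen_Ioi).1 hF).2
  have hF2 : ContDiffOn ℝ ∞ (deriv (deriv F)) (Ioi 0) :=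
    ((contDiffOn_infty_iff_deriv_of_isOpen isOpen_Ioi).1 hF1).2
  have hφ1 := φ.contDiff_deriv
  have hφ2 := (contDiff_infty_iff_deriv.1 hφ1).2
  have s0 : ∀ x : ℝ, x ∉ Ioi (0 : ℝ) → (φ : ℝ → ℂ) =ᶠ[𝓝 x] 0 := fun x hx =>
    notMem_tsupport_iff_eventuallyEq.1 fun h => hx (φ.tsupport_subset h)
  have s1 : ∀ x : ℝ, x ∉ Ioi (0 : ℝ) → deriv (φ : ℝ → ℂ) =ᶠ[𝓝 x] 0 := fun x hx => by
    have := (s0 x hx).deriv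
    simpa using this
  have s2 : ∀ x : ℝ, x ∉ Ioi (0 : ℝ) → deriv (deriv (φ : ℝ → ℂ)) =ᶠ[𝓝 x] 0 := fun x hx => by
    have := (s1 x hx).deriv
    simpa using this
  -- a product of a function continuous on the half-line and one vanishing off it is continuous
  have cont : ∀ (A B : ℝ → ℂ), ContinuousOn A (Ioi 0) → Continuous B →
      (∀ x : ℝ, x ∉ Ioi (0 : ℝ) → B =ᶠ[𝓝 x] 0) → Continuous (fun x => A x * B x) := by
    intro A B hA hB hz
    rw [continuous_iff_continuousAt]
    intro x
    by_cases hx : x ∈ Ioi (0 : ℝ)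
    · exact (hA.continuousAt (isOpen_Ioi.mem_nhds hx)).mul hB.continuousAt
    · have : (fun x => A x * B x) =ᶠ[𝓝 x] fun _ => 0 := by
        filter_upwards [hz x hx] with y hy
        rw [hy]
        simp
      exact continuousAt_const.congr this.symm
  have int : ∀ (A B : ℝ → ℂ), ContinuousOn A (Ioi 0) → Continuous B → HasCompactSupport B →
      (∀ x : ℝ, x ∉ Ioi (0 : ℝ) → B =ᶠ[𝓝 x] 0) → Integrable (fun x => A x * B x) := by
    intro A B hA hB hc hz
    exact (cont A B hA hB hz).integrable_of_hasCompactSupport hc.mul_left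
  have i1 := int F _ hF.continuousOn hφ2.continuous φ.hasCompactSupport.deriv.deriv s2
  have i2 := int _ φ hF2.continuousOn φ.continuous φ.hasCompactSupport s0
  have i3 := int F _ hF.continuousOn hφ1.continuous φ.hasCompactSupport.deriv s1
  have i4 := int _ φ hF1.continuousOn φ.continuous φ.hasCompactSupport s0
  have hd : ∀ x : ℝ, HasDerivAt (fun x => F x * deriv φ x - deriv F x * φ x)
      (F x * deriv (deriv φ) x - deriv (deriv F) x * φ x) x := by
    intro x
    by_cases hx : x ∈ Ioi (0 : ℝ)
    · have a1 := ((hF.contDiffAt (isOpen_Ioi.mem_nhds hx)).differentiableAt (by simp)).hasDerivAt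
      have a2 := ((hF1.contDiffAt (isOpen_Ioi.mem_nhds hx)).differentiableAt (by simp)).hasDerivAt
      have b1 := (φ.contDiff.differentiable (by simp) x).hasDerivAt
      have b2 := (hφ1.differentiable (by simp) x).hasDerivAt
      exact ((a1.mul b2).sub (a2.mul b1)).congr_deriv (by ring)
    · have e : (fun x => F x * deriv φ x - deriv F x * φ x) =ᶠ[𝓝 x] fun _ => 0 := by
        filter_upwards [s0 x hx, s1 x hx] with y h0 h1
        rw [h0, h1]
        simp
      rw [(s0 x hx).eq_of_nhds, (s2 x hx).eq_of_nhds]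
      simpa using (hasDerivAt_const x (0 : ℂ)).congr_of_eventuallyEq e
  have h0 := integral_eq_zero_of_hasDerivAt_of_integrable hd (i1.sub i2) (i3.sub i4)
  have h1 : ∫ x in Ioi (0 : ℝ), (F x * deriv (deriv φ) x - deriv (deriv F) x * φ x) = 0 := by
    rw [← h0]
    refine setIntegral_eq_integral_of_forall_compl_eq_zero fun x hx => ?_
    rw [(s0 x hx).eq_of_nhds, (s2 x hx).eq_of_nhds]
    simp
  have hq : ContinuousOn (fun ρ : ℝ => (((m ^ 2 - 1 / 4) / ρ ^ 2 : ℝ) : ℂ)) (Ioi 0) := by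
    refine Complex.continuous_ofReal.comp_continuousOn ?_
    exact continuousOn_const.div (continuousOn_id.pow 2) fun x hx => pow_ne_zero 2 (ne_of_gt hx)
  have i5 := int _ φ (hq.mul hF.continuousOn) φ.continuous φ.hasCompactSupport s0
  have e1 : ∀ x, calogeroExpr m F x * φ x - F x * calogeroExpr m φ x =
      F x * deriv (deriv φ) x - deriv (deriv F) x * φ x := by
    intro x
    simp only [calogeroExpr]
    ring
  rw [← sub_eq_zero, ← integral_sub, ← h1]
  · simp only [e1]
  · refine ((i5.sub i2).integrableOn (s := Ioi 0)).congr (ae_of_all _ fun x => ?_)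
    simp only [calogeroExpr, Pi.sub_apply, Pi.mul_apply]
    ring
  · refine ((i5.sub i1).integrableOn (s := Ioi 0)).congr (ae_of_all _ fun x => ?_)
    simp only [calogeroExpr, Pi.sub_apply, Pi.mul_apply]
    ring

theorem inner_calogeroExpr {m : ℝ} {F : ℝ → ℂ} (hF : ContDiffOn ℝ ∞ F (Ioi 0))
    (h1 : MemLp F 2 (volume.restrict (Ioi (0 : ℝ))))
    (h2 : MemLp (calogeroExpr m F) 2 (volume.restrict (Ioi (0 : ℝ)))) (u : (preH₀ m).domain) :
    inner ℂ (h2.toLp _ : L2) (u : L2) = inner ℂ (h1.toLp _ : L2) (preH₀ m u) := by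
  obtain ⟨_, φ, rfl⟩ := u
  rw [preH₀_apply, L2.inner_def, L2.inner_def]
  have hG : ContDiffOn ℝ ∞ (fun y => starRingEnd ℂ (F y)) (Ioi 0) :=
    Complex.conjCLE.contDiff.comp_contDiffOn hF
  have e : ∀ x, calogeroExpr m (fun y => starRingEnd ℂ (F y)) x
      = starRingEnd ℂ (calogeroExpr m F x) := by
    intro x
    have : deriv (fun y => starRingEnd ℂ (F y)) = fun y => starRingEnd ℂ (deriv F y) :=
      funext (deriv_conj F)
    simp only [calogeroExpr, this, deriv_conj (deriv F) x, map_add, map_neg, map_mul,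
      Complex.conj_ofReal]
  have g := integral_green m hG φ
  simp only [e] at g
  calc _ = ∫ ρ in Ioi (0 : ℝ), (starRingEnd ℂ) (calogeroExpr m F ρ) * φ ρ := by
        refine integral_congr_ae ?_
        filter_upwards [h2.coeFn_toLp, φ.memLp.coeFn_toLp] with x hx hy
        have hy' : (TestFn.toL2 φ : ℝ → ℂ) x = φ x := hy
        rw [hx, hy', RCLike.inner_apply, mul_comm]
    _ = _ := g
    _ = _ := by
        refine integral_congr_ae ?_
        filter_upwards [h1.coeFn_toLp, (φ.memLp_calogeroExpr m).coeFn_toLp] with x hx hy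
        have hy' : (TestFn.calogero m φ : ℝ → ℂ) x = calogeroExpr m φ x := hy
        rw [hx, hy', RCLike.inner_apply, mul_comm]

theorem preH₀_isFormalAdjoint (m : ℝ) : (preH₀ m).IsFormalAdjoint (preH₀ m) := by
  rintro ⟨_, φ, rfl⟩ v
  rw [preH₀_apply]
  exact inner_calogeroExpr φ.contDiff.contDiffOn φ.memLp (φ.memLp_calogeroExpr m) v

/-- `preH₀` is closable, so that its closure is not a default value. -/
theorem preH₀_isClosable (m : ℝ) : (preH₀ m).IsClosable :=
  LinearPMap.isClosable_iff_exists_closed_extension.2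
    ⟨_, LinearPMap.adjoint_isClosed (dense_preH₀_domain m),
      (preH₀_isFormalAdjoint m).le_adjoint (dense_preH₀_domain m)⟩

theorem closure_le_adjoint (m : ℝ) : (preH₀ m).closure ≤ (preH₀ m).adjoint := by
  have h1 := LinearPMap.adjoint_isClosed (dense_preH₀_domain m)
  have h2 := (preH₀_isFormalAdjoint m).le_adjoint (dense_preH₀_domain m)
  apply LinearPMap.le_of_le_graph
  rw [← (preH₀_isClosable m).graph_closure_eq_closure_graph]
  exact Submodule.topologicalClosure_minimal _ (LinearPMap.le_graph_of_le h2) h1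

theorem contDiffOn_zetaFn {m : ℝ} {ζ : ℝ → ℝ} (hζ : IsCutoff ζ) :
    ContDiffOn ℝ ∞ (zetaFn m ζ) (Ioi 0) := by
  refine Complex.ofRealCLM.contDiff.comp_contDiffOn ?_
  refine (hζ.smooth.mono Ioi_subset_Ici_self).mul fun x hx => ?_
  exact (Real.contDiffAt_rpow_const_of_ne (ne_of_gt hx)).contDiffWithinAt

theorem deriv_ofReal_rpow (c a : ℝ) {x : ℝ} (hx : 0 < x) :
    deriv (fun ρ : ℝ => ((c * ρ ^ a : ℝ) : ℂ)) x = ((c * a * x ^ (a - 1) : ℝ) : ℂ) := by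
  have := ((Real.hasDerivAt_rpow_const (p := a) (Or.inl hx.ne')).const_mul c).ofReal_comp
  rw [this.deriv, mul_assoc]

theorem calogeroExpr_zetaFn_of_lt_one {m : ℝ} {ζ : ℝ → ℝ} (hζ : IsCutoff ζ) {x : ℝ} (h0 : 0 < x)
    (h1 : x < 1) : calogeroExpr m (zetaFn m ζ) x = 0 := by
  have e0 : EqOn (zetaFn m ζ) (fun ρ : ℝ => ((1 * ρ ^ (1 / 2 + m) : ℝ) : ℂ)) (Ioo 0 1) :=
    fun ρ hρ => by
      simp only [zetaFn, hζ.eq_one ρ hρ.1.le hρ.2.le]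
  have e1 : EqOn (deriv (zetaFn m ζ))
      (fun ρ : ℝ => ((1 * (1 / 2 + m) * ρ ^ (1 / 2 + m - 1) : ℝ) : ℂ)) (Ioo 0 1) := fun ρ hρ => by
    rw [(e0.eventuallyEq_of_mem (isOpen_Ioo.mem_nhds hρ)).deriv_eq]
    exact deriv_ofReal_rpow _ _ hρ.1
  have e2 := (e1.eventuallyEq_of_mem (isOpen_Ioo.mem_nhds ⟨h0, h1⟩)).deriv_eq
  rw [deriv_ofReal_rpow _ _ h0] at e2
  rw [calogeroExpr, e2, e0 ⟨h0, h1⟩]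
  have e3 : x ^ (1 / 2 + m) = x ^ (1 / 2 + m - 1 - 1) * x ^ 2 := by
    rw [← Real.rpow_natCast x 2, ← Real.rpow_add h0]
    congr 1
    push_cast
    ring
  beta_reduce
  rw [e3]
  norm_cast
  field_simp
  ring

theorem memLp_calogeroExpr_zetaFn {m : ℝ} {ζ : ℝ → ℝ} (hζ : IsCutoff ζ) :
    MemLp (calogeroExpr m (zetaFn m ζ)) 2 (volume.restrict (Ioi (0 : ℝ))) := by
  have hF := contDiffOn_zetaFn (m := m) hζ
  have hF1 := ((contDiffOn_infty_iff_deriv_of_isOpen isOpen_Ioi).1 hF).2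
  have hF2 := ((contDiffOn_infty_iff_deriv_of_isOpen isOpen_Ioi).1 hF1).2
  have hq : ContinuousOn (fun ρ : ℝ => (((m ^ 2 - 1 / 4) / ρ ^ 2 : ℝ) : ℂ)) (Ioi 0) := by
    refine Complex.continuous_ofReal.comp_continuousOn ?_
    exact continuousOn_const.div (continuousOn_id.pow 2) fun x hx => pow_ne_zero 2 (ne_of_gt hx)
  have hs : Icc (1 : ℝ) 2 ⊆ Ioi 0 := fun x hx => lt_of_lt_of_le one_pos hx.1
  have hc : ContinuousOn (calogeroExpr m (zetaFn m ζ)) (Icc 1 2) :=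
    (hF2.continuousOn.neg.add (hq.mul hF.continuousOn)).mono hs
  have h1 : MemLp (calogeroExpr m (zetaFn m ζ)) 2 (volume.restrict (Icc (1 : ℝ) 2)) := by
    obtain ⟨C, hC⟩ := isCompact_Icc.exists_bound_of_continuousOn hc
    refine MemLp.of_bound (hc.aestronglyMeasurable measurableSet_Icc) C ?_
    exact (ae_restrict_mem measurableSet_Icc).mono hC
  rw [← memLp_indicator_iff_restrict measurableSet_Icc] at h1
  refine (h1.restrict (Ioi 0)).ae_eq ?_
  filter_upwards [ae_restrict_mem measurableSet_Ioi] with ρ hρ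
  by_cases h2 : ρ ∈ Icc (1 : ℝ) 2
  · exact indicator_of_mem h2 _
  · rw [indicator_of_notMem h2]
    by_cases h3 : ρ < 1
    · exact (calogeroExpr_zetaFn_of_lt_one hζ hρ h3).symm
    · have h4 : 2 < ρ := lt_of_not_ge fun h => h2 ⟨le_of_not_gt h3, h⟩
      have e0 : zetaFn m ζ =ᶠ[𝓝 ρ] fun _ => 0 := by
        filter_upwards [Ioi_mem_nhds h4] with y hy
        rw [zetaFn, hζ.eq_zero y (le_of_lt hy)]
        simp
      have e1 : deriv (zetaFn m ζ) =ᶠ[𝓝 ρ] fun _ => 0 := by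
        simpa using e0.deriv
      rw [calogeroExpr, e0.eq_of_nhds, e1.deriv_eq]
      simp

/-- The domain of `H₀` is all of `D(closure of preH₀) + ℂ ζ_m`. -/
theorem H₀_domain (m : ℝ) (hm : 0 ≤ m) (ζ : ℝ → ℝ) (hζ : IsCutoff ζ) :
    (H₀ m hm ζ hζ).domain = domH₀ m hm ζ hζ := by
  rw [H₀, LinearPMap.domRestrict_domain, inf_eq_left, domH₀, sup_le_iff]
  refine ⟨(closure_le_adjoint m).1, ?_⟩
  rw [Submodule.span_singleton_le_iff_mem]
  exact LinearPMap.mem_adjoint_domain_of_exists _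
    ⟨_, inner_calogeroExpr (contDiffOn_zetaFn hζ) (memLp_zetaFn hm hζ)
      (memLp_calogeroExpr_zetaFn hζ)⟩

/-- `H₀` extends `preH₀`. -/
theorem preH₀_le_H₀ (m : ℝ) (hm : 0 ≤ m) (ζ : ℝ → ℝ) (hζ : IsCutoff ζ) :
    preH₀ m ≤ H₀ m hm ζ hζ := by
  have h1 := (LinearPMap.le_closure _).trans (closure_le_adjoint m)
  refine ⟨?_, fun x y hxy => ?_⟩
  · rw [H₀_domain]
    exact (LinearPMap.le_closure _).1.trans le_sup_left
  · have hy : (y : L2) ∈ (preH₀ m).adjoint.domain := y.2.2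
    rw [h1.2 (y := ⟨y, hy⟩) hxy]
    exact (LinearPMap.domRestrict_apply rfl).symm

/-- The operator of multiplication by a real function `w` in `L²(0,∞)`, on its maximal domain
`{u | w u ∈ L²(0,∞)}`. -/
def mulOp (w : ℝ → ℝ) : L2 →ₗ.[ℂ] L2 where
  domain :=
    { carrier := {u | MemLp (fun ρ => (w ρ : ℂ) * u ρ) 2 (volume.restrict (Ioi (0 : ℝ)))}
      add_mem' := fun {u v} hu hv => by
        refine (MemLp.add hu hv).ae_eq ?_
        filter_upwards [Lp.coeFn_add u v] with ρ h
        simp only [Pi.add_apply, h]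
        ring
      zero_mem' := by
        refine (MemLp.zero (p := 2) (ε := ℂ)).ae_eq ?_
        filter_upwards [Lp.coeFn_zero ℂ 2 (volume.restrict (Ioi (0 : ℝ)))] with ρ h
        have h' : (((0 : L2) : ℝ → ℂ)) ρ = 0 := h
        change (0 : ℂ) = (w ρ : ℂ) * ((0 : L2) : ℝ → ℂ) ρ
        rw [h', mul_zero]
      smul_mem' := fun c u hu => by
        refine (MemLp.const_smul hu c).ae_eq ?_
        filter_upwards [Lp.coeFn_smul c u] with ρ h
        simp only [Pi.smul_apply, h, smul_eq_mul]
        ring }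
  toFun :=
    { toFun := fun u => MemLp.toLp _ u.2
      map_add' := fun u v => by
        rw [← MemLp.toLp_add]
        refine MemLp.toLp_congr _ _ ?_
        filter_upwards [Lp.coeFn_add (u : L2) (v : L2)] with ρ h
        simp only [Submodule.coe_add, Pi.add_apply, h]
        ring
      map_smul' := fun c u => by
        rw [RingHom.id_apply, ← MemLp.toLp_const_smul]
        refine MemLp.toLp_congr _ _ ?_
        filter_upwards [Lp.coeFn_smul c (u : L2)] with ρ h
        simp only [Submodule.coe_smul, Pi.smul_apply, h, smul_eq_mul]
        ring }

/-- The operator `C` is relatively compact with respect to `A`: `D(A) ⊆ D(C)`, and for every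
sequence `u n` in `D(A)` such that `u n` and `A (u n)` are bounded, the sequence `C (u n)` has a
convergent subsequence. -/
def IsRelativelyCompact (C A : L2 →ₗ.[ℂ] L2) : Prop :=
  ∃ hdom : A.domain ≤ C.domain,
    ∀ u : ℕ → A.domain,
      (∃ M : ℝ, ∀ n, ‖(u n : L2)‖ ≤ M ∧ ‖A (u n)‖ ≤ M) →
        ∃ (g : L2) (k : ℕ → ℕ), StrictMono k ∧
          Tendsto (fun n => C ⟨(u (k n) : L2), hdom (u (k n)).2⟩) atTop (𝓝 g)

/-- `R` is the resolvent `(A - z)⁻¹`: a bounded everywhere defined two-sided inverse of `A - z`. -/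
def IsResolventAt (A : L2 →ₗ.[ℂ] L2) (z : ℂ) (R : L2 →L[ℂ] L2) : Prop :=
  (∀ f : L2, ∃ h : R f ∈ A.domain, A ⟨R f, h⟩ - z • R f = f) ∧
    ∀ u : A.domain, R (A u - z • (u : L2)) = u

/-- The conditions on the potential `V : (0,∞) → ℝ`: it is `c₂/ρ² + W(ρ)` with `c₂ ≥ -1/4` and
`W : [0,∞) → ℝ` continuous and bounded, `W → C₀` at infinity, and `W - C₀` square integrable
on `[1,∞)`. -/
structure PotentialAssumption (V W : ℝ → ℝ) (c₂ C₀ : ℝ) : Prop where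
  c₂_ge : -(1 / 4) ≤ c₂
  V_eq : ∀ ρ, 0 < ρ → V ρ = c₂ / ρ ^ 2 + W ρ
  continuous_W : ContinuousOn W (Ici 0)
  bounded_W : ∃ B : ℝ, ∀ ρ, 0 ≤ ρ → |W ρ| ≤ B
  tendsto_W : Tendsto W atTop (𝓝 C₀)
  sq_integrable : IntegrableOn (fun ρ => (W ρ - C₀) ^ 2) (Ici 1)

end HalfLine

end

/-! Write `A φ = φ' - φ/(2ρ)`. For a test function `φ`, integrating `Re(φ̄ H φ)` by parts gives `‖A
φ‖² + m² ‖φ/ρ‖² = Re⟨φ, H φ⟩`. Hence `‖A φ‖` is controlled by the graph norm for every `m`,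
including the critical case `m = 0`, in which the graph norm need not control `φ/ρ` or `φ'`
separately (`integral_norm_hardyDeriv_sq_le`). Since `(|φ|²/ρ)' = 2 Re(φ̄ A φ)/ρ`, this yields a
uniform bound on `φ` (`TestFn.norm_apply_le`). Away from the origin `φ' = A φ + φ/(2ρ)` is then
controlled as well, which gives equicontinuity at each point of `(0,∞)`. A graph-bounded sequence of
test functions therefore has a subsequence converging pointwise on `(0,∞)`. It is uniformly bounded
and `W - C₀` is square integrable, so dominated convergence makes `(W - C₀) φ` converge in `L²`
(`seqCompactOn_graph_preH₀`).

Compactness is phrased for a bounded operator on a subspace, here multiplication composed with the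
first projection on a graph. In that form it passes to the closure of the subspace and to a
one-dimensional enlargement. This reaches the graph of `H₀`, because `H₀` adds only the line through
`ζ_m` to the closure of `preH₀`. The resolvent statement follows because the resolvent is bounded
into the graph norm. -/

noncomputable section

/-! ### Sequential compactness of a bounded operator on a subspace -/

section SeqCompact

variable {E F : Type*} [NormedAddCommGroup E] [NormedSpace ℂ E] [NormedAddCommGroup F]
  [NormedSpace ℂ F]

/-- `K` maps every bounded sequence in `G` to a sequence with a convergent subsequence. -/
def SeqCompactOn (K : E →L[ℂ] F) (G : Submodule ℂ E) : Prop :=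
  ∀ u : ℕ → E, (∀ n, u n ∈ G) → ∀ M : ℝ, (∀ n, ‖u n‖ ≤ M) →
    ∃ (g : F) (k : ℕ → ℕ), StrictMono k ∧ Tendsto (fun n => K (u (k n))) atTop (𝓝 g)

/-- A sequence in the closure differs from one in `G` by a null sequence, and the continuous `K`
sends that difference to a null sequence. -/
theorem SeqCompactOn.topologicalClosure {K : E →L[ℂ] F} {G : Submodule ℂ E}
    (h : SeqCompactOn K G) : SeqCompactOn K G.topologicalClosure := by
  intro u hu M hM
  have h1 : ∀ n, ∃ v ∈ G, dist (u n) v < 1 / ((n : ℝ) + 1) := fun n =>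
    Metric.mem_closure_iff.1 (hu n) _ Nat.one_div_pos_of_nat
  choose v hv huv using h1
  -- The approximation errors are at most `1`, so the approximants are bounded by `M + 1`.
  obtain ⟨g, k, hk, hg⟩ := h v hv (M + 1) fun n => by
    have h2 : 1 / ((n : ℝ) + 1) ≤ 1 := by
      rw [div_le_one (by positivity)]
      linarith [(Nat.cast_nonneg n : (0 : ℝ) ≤ n)]
    have h3 : ‖v n‖ ≤ ‖u n‖ + ‖u n - v n‖ := norm_le_insert _ _
    rw [← dist_eq_norm] at h3
    linarith [hM n, huv n]
  refine ⟨g, k, hk, ?_⟩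
  have h4 : Tendsto (fun n => u n - v n) atTop (𝓝 0) :=
    squeeze_zero_norm (fun n => by rw [← dist_eq_norm]; exact (huv n).le)
      tendsto_one_div_add_atTop_nhds_zero_nat
  have h5 := hg.add ((K.continuous.tendsto 0).comp (h4.comp hk.tendsto_atTop))
  simpa using h5

/-- If `e` lies at distance `d > 0` from the closed subspace `G`, then `‖a + c • e‖ ≥ |c| d`. A
bounded sequence thus has bounded coefficients along `e` and bounded components in `G`; a
subsequence is extracted from each in turn. -/
theorem SeqCompactOn.sup_span_singleton {K : E →L[ℂ] F} {G : Submodule ℂ E}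
    (h : SeqCompactOn K G) (hG : IsClosed (G : Set E)) (e : E) :
    SeqCompactOn K (G ⊔ Submodule.span ℂ {e}) := by
  by_cases he : e ∈ G
  · rwa [sup_eq_left.2 ((Submodule.span_singleton_le_iff_mem _ _).2 he)]
  have hd : 0 < Metric.infDist e G := (hG.notMem_iff_infDist_pos ⟨0, G.zero_mem⟩).1 he
  set d := Metric.infDist e G with hd_def
  intro u hu M hM
  have h1 : ∀ n, ∃ a ∈ G, ∃ c : ℂ, a + c • e = u n := fun n => by
    obtain ⟨a, ha, b, hb, hab⟩ := Submodule.mem_sup.1 (hu n)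
    obtain ⟨c, rfl⟩ := Submodule.mem_span_singleton.1 hb
    exact ⟨a, ha, c, hab⟩
  choose a ha c hac using h1
  have hc : ∀ n, ‖c n‖ ≤ M / d := fun n => by
    rw [le_div_iff₀ hd]
    refine le_trans ?_ (hM n)
    by_cases h0 : c n = 0
    · simp [h0]
    have h2 : d ≤ ‖e + (c n)⁻¹ • a n‖ := by
      have := Metric.infDist_le_dist_of_mem (x := e)
        (G.neg_mem (G.smul_mem (c n)⁻¹ (ha n)) : -((c n)⁻¹ • a n) ∈ (G : Set E))
      rwa [dist_eq_norm, sub_neg_eq_add] at this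
    have h3 : u n = c n • (e + (c n)⁻¹ • a n) := by
      rw [smul_add, smul_inv_smul₀ h0, ← hac n, add_comm]
    rw [h3, norm_smul]
    gcongr
  obtain ⟨c', -, j, hj, hc'⟩ := tendsto_subseq_of_bounded (Metric.isBounded_closedBall (x := (0 : ℂ))
    (r := M / d)) (x := c) fun n => by simpa using hc n
  obtain ⟨g, k, hk, hg⟩ := h (fun n => a (j n)) (fun n => ha _) (M + M / d * ‖e‖) fun n => by
    have h2 : a (j n) = u (j n) - c (j n) • e := by rw [← hac]; abel
    rw [h2]
    refine (norm_sub_le _ _).trans (add_le_add (hM _) ?_)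
    rw [norm_smul]
    gcongr
    exact hc _
  refine ⟨g + c' • K e, j ∘ k, hj.comp hk, ?_⟩
  have h3 := hg.add ((hc'.comp hk.tendsto_atTop).smul_const (K e))
  refine h3.congr fun n => ?_
  simp [← hac]

/-- Points in the closure of the image of the unit ball are approximated by images of ball points
with errors tending to `0`, so subsequential convergence transfers to the closure. -/
theorem isCompactOperator_of_seq [CompleteSpace F] (T : E →L[ℂ] F) (h : SeqCompactOn T ⊤) :
    IsCompactOperator T := by
  rw [← ContinuousLinearMap.coe_coe,
    isCompactOperator_iff_isCompact_closure_image_closedBall _ one_pos]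
  rw [isCompact_iff_isSeqCompact]
  intro y hy
  have h1 : ∀ n, ∃ u ∈ Metric.closedBall (0 : E) 1, dist (y n) (T u) < 1 / ((n : ℝ) + 1) :=
    fun n => by
      obtain ⟨_, ⟨u, hu, rfl⟩, hb⟩ := Metric.mem_closure_iff.1 (hy n) _ Nat.one_div_pos_of_nat
      exact ⟨u, hu, hb⟩
  choose u hu huy using h1
  obtain ⟨g, k, hk, hg⟩ := h u (fun _ => Submodule.mem_top) 1 fun n => by simpa using hu n
  have h2 : Tendsto (fun n => y n - T (u n)) atTop (𝓝 0) :=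
    squeeze_zero_norm (fun n => by rw [← dist_eq_norm]; exact (huy n).le)
      tendsto_one_div_add_atTop_nhds_zero_nat
  have h3 : Tendsto (y ∘ k) atTop (𝓝 g) := by
    simpa [Function.comp_def] using (h2.comp hk.tendsto_atTop).add hg
  exact ⟨g, isClosed_closure.mem_of_tendsto h3 (Eventually.of_forall fun n => hy _), k, hk, h3⟩

end SeqCompact

/-! ### Energy and pointwise estimates for smooth functions -/

namespace HalfLine

/-- The first order operator `φ ↦ φ' - φ/(2ρ)`, which factorizes `-d²/dρ² - 1/(4ρ²)`. -/
def hardyDeriv (φ : ℝ → ℂ) (ρ : ℝ) : ℂ := deriv φ ρ - ((1 / (2 * ρ) : ℝ) : ℂ) * φ ρ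

section Smooth

variable {φ : ℝ → ℂ}

theorem hasDerivAt_of_contDiff_infty (hφ : ContDiff ℝ ∞ φ) (x : ℝ) :
    HasDerivAt φ (deriv φ x) x :=
  (hφ.differentiable (by simp) x).hasDerivAt

theorem contDiff_infty_deriv (hφ : ContDiff ℝ ∞ φ) : ContDiff ℝ ∞ (deriv φ) :=
  (contDiff_infty_iff_deriv.1 hφ).2

theorem continuousOn_hardyDeriv (hφ : ContDiff ℝ ∞ φ) : ContinuousOn (hardyDeriv φ) (Ioi 0) := by
  refine (contDiff_infty_deriv hφ).continuous.continuousOn.sub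
    (ContinuousOn.mul ?_ hφ.continuous.continuousOn)
  refine Complex.continuous_ofReal.comp_continuousOn ?_
  exact continuousOn_const.div (continuousOn_const.mul continuousOn_id) fun x hx =>
    mul_ne_zero two_ne_zero (ne_of_gt hx)

theorem continuousOn_calogeroExpr (m : ℝ) (hφ : ContDiff ℝ ∞ φ) :
    ContinuousOn (calogeroExpr m φ) (Ioi 0) := by
  refine (contDiff_infty_deriv (contDiff_infty_deriv hφ)).continuous.continuousOn.neg.add
    (ContinuousOn.mul ?_ hφ.continuous.continuousOn)
  refine Complex.continuous_ofReal.comp_continuousOn ?_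
  exact continuousOn_const.div (continuousOn_id.pow 2) fun x hx => pow_ne_zero 2 (ne_of_gt hx)

theorem uIcc_subset_Ioi_zero {a b : ℝ} (ha : 0 < a) (hab : a ≤ b) : uIcc a b ⊆ Ioi (0 : ℝ) := by
  rw [uIcc_of_le hab]
  exact fun x hx => lt_of_lt_of_le ha hx.1

/-- The energy estimate: Hardy's inequality with remainder. -/
theorem integral_norm_hardyDeriv_sq_le (m : ℝ) (hφ : ContDiff ℝ ∞ φ) {a b : ℝ} (ha : 0 < a)
    (hab : a ≤ b) (h0 : φ a = 0) (h1 : φ b = 0) :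
    ∫ ρ in a..b, ‖hardyDeriv φ ρ‖ ^ 2 ≤
      ∫ ρ in a..b, (‖φ ρ‖ ^ 2 + ‖calogeroExpr m φ ρ‖ ^ 2) / 2 := by
  have hsub := uIcc_subset_Ioi_zero ha hab
  have hφ1 := contDiff_infty_deriv hφ
  have hφ2 := contDiff_infty_deriv hφ1
  -- The derivative of `Re(φ̄ A φ) = Re(φ̄ φ') - |φ|²/(2ρ)`, whose boundary values vanish at `a` and
  -- `b`.
  set D : ℝ → ℝ := fun ρ => (inner ℝ (φ ρ) (deriv (deriv φ) ρ) + inner ℝ (deriv φ ρ) (deriv φ ρ)) -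
    (2 * inner ℝ (φ ρ) (deriv φ ρ) * (2 * ρ) - ‖φ ρ‖ ^ 2 * 2) / (2 * ρ) ^ 2 with hD
  have hder : ∀ ρ ∈ uIcc a b,
      HasDerivAt (fun ρ => inner ℝ (φ ρ) (deriv φ ρ) - ‖φ ρ‖ ^ 2 / (2 * ρ)) (D ρ) ρ := by
    intro ρ hρ
    have hρ0 : 2 * ρ ≠ 0 := mul_ne_zero two_ne_zero (ne_of_gt (hsub hρ))
    have d0 := hasDerivAt_of_contDiff_infty hφ ρ
    have d1 := hasDerivAt_of_contDiff_infty hφ1 ρ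
    have d2 : HasDerivAt (fun ρ : ℝ => 2 * ρ) 2 ρ := by
      simpa using (hasDerivAt_id ρ).const_mul 2
    exact (d0.inner ℝ d1).sub (d0.norm_sq.div d2 hρ0)
  have hDc : ContinuousOn D (uIcc a b) := by
    refine ContinuousOn.sub ?_ (ContinuousOn.div ?_ ?_ fun x hx =>
      pow_ne_zero 2 (mul_ne_zero two_ne_zero (ne_of_gt (hsub hx))))
    · exact ((hφ.continuous.inner hφ2.continuous).add
        (hφ1.continuous.inner hφ1.continuous)).continuousOn
    · have := hφ.continuous.inner hφ1.continuous (𝕜 := ℝ)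
      have := hφ.continuous
      fun_prop
    · fun_prop
  have hint := intervalIntegral.integral_eq_sub_of_hasDerivAt hder hDc.intervalIntegrable
  rw [h0, h1] at hint
  simp only [inner_zero_left, norm_zero, ne_eq, OfNat.ofNat_ne_zero, not_false_eq_true, zero_pow,
    zero_div, sub_zero] at hint
  have hRc : ContinuousOn (fun ρ => (‖φ ρ‖ ^ 2 + ‖calogeroExpr m φ ρ‖ ^ 2) / 2) (uIcc a b) :=
    ((hφ.continuous.norm.pow 2).continuousOn.add
      (((continuousOn_calogeroExpr m hφ).mono hsub).norm.pow 2)).div_const 2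
  have hgc : ContinuousOn (fun ρ => ‖hardyDeriv φ ρ‖ ^ 2) (uIcc a b) :=
    ((continuousOn_hardyDeriv hφ).mono hsub).norm.pow 2
  calc ∫ ρ in a..b, ‖hardyDeriv φ ρ‖ ^ 2
      ≤ ∫ ρ in a..b, (D ρ + (‖φ ρ‖ ^ 2 + ‖calogeroExpr m φ ρ‖ ^ 2) / 2) := by
        refine intervalIntegral.integral_mono_on hab hgc.intervalIntegrable
          (hDc.add hRc).intervalIntegrable fun ρ hρ => ?_
        have hρ0 : ρ ≠ 0 := ne_of_gt (lt_of_lt_of_le ha hρ.1)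
        -- Pointwise `D - |A φ|² = (m/ρ)² |φ|² - Re(φ̄ H φ)`; completing the square leaves a sum of
        -- nonnegative terms for every real `m`.
        have key : D ρ + (‖φ ρ‖ ^ 2 + ‖calogeroExpr m φ ρ‖ ^ 2) / 2 - ‖hardyDeriv φ ρ‖ ^ 2 =
            ‖φ ρ - calogeroExpr m φ ρ‖ ^ 2 / 2 + (m / ρ) ^ 2 * ‖φ ρ‖ ^ 2 := by
          simp only [hD, hardyDeriv, calogeroExpr, Complex.sq_norm, Complex.normSq_apply,
            Complex.inner, Complex.sub_re, Complex.sub_im, Complex.add_re, Complex.add_im,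
            Complex.neg_re, Complex.neg_im, Complex.ofReal_re, Complex.ofReal_im,
            Complex.mul_re, Complex.mul_im, Complex.conj_re, Complex.conj_im]
          field_simp
          ring
        have : 0 ≤ ‖φ ρ - calogeroExpr m φ ρ‖ ^ 2 / 2 + (m / ρ) ^ 2 * ‖φ ρ‖ ^ 2 := by positivity
        linarith
    _ = _ := by
        rw [intervalIntegral.integral_add hDc.intervalIntegrable hRc.intervalIntegrable, hint,
          zero_add]

/-- Dividing by `ρ` removes the singular term: `(|φ|²/ρ)' = 2 Re(φ̄ A φ)/ρ`. Integrating from `x` to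
a zero of `φ` and using `ρ⁻¹ ≤ x⁻¹`, the factor `x` cancels, so the bound is uniform down to the
origin. -/
theorem norm_sq_le_integral (hφ : ContDiff ℝ ∞ φ) {x b : ℝ} (hx : 0 < x) (hxb : x ≤ b)
    (h1 : φ b = 0) : ‖φ x‖ ^ 2 ≤ ∫ ρ in x..b, (‖φ ρ‖ ^ 2 + ‖hardyDeriv φ ρ‖ ^ 2) := by
  have hsub := uIcc_subset_Ioi_zero hx hxb
  have hφ1 := contDiff_infty_deriv hφ
  set D : ℝ → ℝ := fun ρ => (2 * inner ℝ (φ ρ) (deriv φ ρ) * ρ - ‖φ ρ‖ ^ 2 * 1) / ρ ^ 2 with hD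
  have hder : ∀ ρ ∈ uIcc x b, HasDerivAt (fun ρ => ‖φ ρ‖ ^ 2 / ρ) (D ρ) ρ := fun ρ hρ =>
    (hasDerivAt_of_contDiff_infty hφ ρ).norm_sq.div (hasDerivAt_id ρ) (ne_of_gt (hsub hρ))
  have hDc : ContinuousOn D (uIcc x b) := by
    refine ContinuousOn.div ?_ ?_ fun x hx => pow_ne_zero 2 (ne_of_gt (hsub hx))
    · have := hφ.continuous.inner hφ1.continuous (𝕜 := ℝ)
      have := hφ.continuous
      fun_prop
    · fun_prop
  have hint := intervalIntegral.integral_eq_sub_of_hasDerivAt hder hDc.intervalIntegrable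
  have hRc : ContinuousOn (fun ρ => ‖φ ρ‖ ^ 2 + ‖hardyDeriv φ ρ‖ ^ 2) (uIcc x b) :=
    (hφ.continuous.norm.pow 2).continuousOn.add
      (((continuousOn_hardyDeriv hφ).mono hsub).norm.pow 2)
  have hle : ∫ ρ in x..b, -D ρ ≤ ∫ ρ in x..b, (‖φ ρ‖ ^ 2 + ‖hardyDeriv φ ρ‖ ^ 2) * x⁻¹ := by
    refine intervalIntegral.integral_mono_on hxb hDc.neg.intervalIntegrable
      (hRc.mul continuousOn_const).intervalIntegrable fun ρ hρ => ?_
    have hρ0 : 0 < ρ := lt_of_lt_of_le hx hρ.1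
    have key : (‖φ ρ‖ ^ 2 + ‖hardyDeriv φ ρ‖ ^ 2) * ρ⁻¹ - -D ρ =
        ‖φ ρ + hardyDeriv φ ρ‖ ^ 2 * ρ⁻¹ := by
      simp only [hD, hardyDeriv, Complex.sq_norm, Complex.normSq_apply,
        Complex.inner, Complex.sub_re, Complex.sub_im, Complex.add_re, Complex.add_im,
        Complex.ofReal_re, Complex.ofReal_im,
        Complex.mul_re, Complex.mul_im, Complex.conj_re, Complex.conj_im]
      field_simp
      ring
    have h2 : 0 ≤ ‖φ ρ + hardyDeriv φ ρ‖ ^ 2 * ρ⁻¹ := by positivity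
    have h3 : (‖φ ρ‖ ^ 2 + ‖hardyDeriv φ ρ‖ ^ 2) * ρ⁻¹ ≤
        (‖φ ρ‖ ^ 2 + ‖hardyDeriv φ ρ‖ ^ 2) * x⁻¹ := by
      gcongr
      exact hρ.1
    linarith
  rw [intervalIntegral.integral_neg, hint, h1, intervalIntegral.integral_mul_const] at hle
  simp only [norm_zero, ne_eq, OfNat.ofNat_ne_zero, not_false_eq_true, zero_pow, zero_div,
    zero_sub, neg_neg] at hle
  rw [← div_eq_mul_inv] at hle
  exact (div_le_div_iff_of_pos_right hx).1 hle

/-- Integrates `|φ'| ≤ |A φ| + |φ|/(2ρ)`. Young's inequality with parameter `ε` replaces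
Cauchy–Schwarz: the energy term is made small through `ε`, the remainder through the length `y - x`.
-/
theorem norm_sub_le_of_integral_hardyDeriv (hφ : ContDiff ℝ ∞ φ) {δ x y S A ε : ℝ} (hδ : 0 < δ)
    (hδx : δ ≤ x) (hxy : x ≤ y) (hε : 0 < ε) (hS : ∀ ρ, ‖φ ρ‖ ≤ S)
    (hA : ∫ ρ in x..y, ‖hardyDeriv φ ρ‖ ^ 2 ≤ A) :
    ‖φ y - φ x‖ ≤ ε / 2 * A + (y - x) * (1 / (2 * ε) + 1 / (2 * δ) * S) := by
  have hx : 0 < x := lt_of_lt_of_le hδ hδx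
  have hsub := uIcc_subset_Ioi_zero hx hxy
  have hφ1 := contDiff_infty_deriv hφ
  have hgc : ContinuousOn (fun ρ => ‖hardyDeriv φ ρ‖ ^ 2) (uIcc x y) :=
    ((continuousOn_hardyDeriv hφ).mono hsub).norm.pow 2
  have hint := intervalIntegral.integral_eq_sub_of_hasDerivAt (a := x) (b := y)
    (fun ρ _ => hasDerivAt_of_contDiff_infty hφ ρ) (hφ1.continuous.intervalIntegrable _ _)
  rw [← hint]
  calc ‖∫ ρ in x..y, deriv φ ρ‖ ≤ ∫ ρ in x..y, ‖deriv φ ρ‖ :=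
        intervalIntegral.norm_integral_le_integral_norm hxy
    _ ≤ ∫ ρ in x..y, (ε / 2 * ‖hardyDeriv φ ρ‖ ^ 2 + (1 / (2 * ε) + 1 / (2 * δ) * S)) := by
        refine intervalIntegral.integral_mono_on hxy
          (hφ1.continuous.norm.intervalIntegrable _ _)
          ((continuousOn_const.mul hgc).add continuousOn_const).intervalIntegrable fun ρ hρ => ?_
        have hδρ : δ ≤ ρ := hδx.trans hρ.1
        have hρ0 : 0 < ρ := hδ.trans_le hδρ
        have e : deriv φ ρ = hardyDeriv φ ρ + ((1 / (2 * ρ) : ℝ) : ℂ) * φ ρ := by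
          rw [hardyDeriv]
          ring
        have h2 : ‖((1 / (2 * ρ) : ℝ) : ℂ) * φ ρ‖ ≤ 1 / (2 * δ) * S := by
          rw [norm_mul, Complex.norm_real, Real.norm_of_nonneg (by positivity)]
          gcongr
          exact hS ρ
        have h3 : ‖hardyDeriv φ ρ‖ ≤ ε / 2 * ‖hardyDeriv φ ρ‖ ^ 2 + 1 / (2 * ε) := by
          have : ε / 2 * ‖hardyDeriv φ ρ‖ ^ 2 + 1 / (2 * ε) - ‖hardyDeriv φ ρ‖ =
              (ε * ‖hardyDeriv φ ρ‖ - 1) ^ 2 / (2 * ε) := by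
            field_simp
            ring
          have : 0 ≤ (ε * ‖hardyDeriv φ ρ‖ - 1) ^ 2 / (2 * ε) := by positivity
          linarith
        have h4 := norm_add_le (hardyDeriv φ ρ) (((1 / (2 * ρ) : ℝ) : ℂ) * φ ρ)
        rw [← e] at h4
        linarith
    _ ≤ _ := by
        rw [intervalIntegral.integral_add (hgc.intervalIntegrable.const_mul _)
          intervalIntegrable_const, intervalIntegral.integral_const_mul,
          intervalIntegral.integral_const, smul_eq_mul]
        gcongr

end Smooth

/-! ### Bounds for test functions in terms of the graph norm -/

theorem norm_sq_eq_integral (u : L2) : ‖u‖ ^ 2 = ∫ ρ in Ioi (0 : ℝ), ‖u ρ‖ ^ 2 := by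
  have h : inner ℂ u u = ((‖u‖ ^ 2 : ℝ) : ℂ) := by
    rw [inner_self_eq_norm_sq_to_K]
    norm_cast
  rw [L2.inner_def] at h
  have h2 : ∀ ρ, inner ℂ (u ρ) (u ρ) = ((‖u ρ‖ ^ 2 : ℝ) : ℂ) := fun ρ => by
    rw [inner_self_eq_norm_sq_to_K]
    norm_cast
  simp only [h2] at h
  rw [integral_complex_ofReal] at h
  exact (Complex.ofReal_injective h).symm

theorem intervalIntegral_norm_sq_le {f : ℝ → ℂ}
    (hf : MemLp f 2 (volume.restrict (Ioi (0 : ℝ)))) {a b : ℝ} (ha : 0 < a) (hab : a ≤ b) :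
    ∫ ρ in a..b, ‖f ρ‖ ^ 2 ≤ ‖(hf.toLp f : L2)‖ ^ 2 := by
  have h1 : IntegrableOn (fun ρ => ‖f ρ‖ ^ 2) (Ioi 0) :=
    (memLp_two_iff_integrable_sq_norm hf.1).1 hf
  have h2 : ∫ ρ in Ioi (0 : ℝ), ‖(hf.toLp f : L2) ρ‖ ^ 2 = ∫ ρ in Ioi (0 : ℝ), ‖f ρ‖ ^ 2 := by
    refine integral_congr_ae ?_
    filter_upwards [hf.coeFn_toLp] with ρ hρ
    rw [hρ]
  rw [norm_sq_eq_integral, h2, intervalIntegral.integral_of_le hab]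
  refine setIntegral_mono_set h1 (ae_of_all _ fun ρ => by positivity) ?_
  exact (show Ioc a b ⊆ Ioi 0 from fun ρ hρ => ha.trans hρ.1).eventuallyLE

theorem TestFn.eq_zero_of_nonpos (φ : TestFn) {x : ℝ} (hx : x ≤ 0) : φ x = 0 :=
  image_eq_zero_of_notMem_tsupport fun h =>
    not_lt_of_ge hx (show (0 : ℝ) < x from φ.tsupport_subset h)

/-- A test function vanishes near `0` and near infinity. -/
theorem TestFn.exists_eq_zero (φ : TestFn) {x y : ℝ} (hx : 0 < x) :
    ∃ a b, 0 < a ∧ a ≤ x ∧ y ≤ b ∧ φ a = 0 ∧ φ b = 0 := by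
  have h1 : ∀ᶠ a in 𝓝[>] (0 : ℝ), φ a = 0 :=
    ((notMem_tsupport_iff_eventuallyEq.1 φ.zero_notMem_tsupport).filter_mono nhdsWithin_le_nhds)
  have h2 : ∀ᶠ a in 𝓝[>] (0 : ℝ), a ∈ Ioc 0 x := Ioc_mem_nhdsGT hx
  obtain ⟨a, ha, ha'⟩ := (h1.and h2).exists
  obtain ⟨B, hB⟩ := φ.hasCompactSupport.isCompact.bddAbove
  refine ⟨a, max y (B + 1), ha'.1, ha'.2, le_max_left _ _, ha, ?_⟩
  refine image_eq_zero_of_notMem_tsupport fun h => ?_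
  linarith [hB h, le_max_right y (B + 1)]

section Bounds

variable {m M : ℝ} {φ : TestFn}

/-- The interval is enlarged until `φ` vanishes at both ends, where the energy estimate applies. -/
theorem TestFn.integral_hardyDeriv_le (h1 : ‖TestFn.toL2 φ‖ ≤ M) (h2 : ‖TestFn.calogero m φ‖ ≤ M)
    {x y : ℝ} (hx : 0 < x) (hxy : x ≤ y) : ∫ ρ in x..y, ‖hardyDeriv φ ρ‖ ^ 2 ≤ M ^ 2 := by
  obtain ⟨a, b, ha, hax, hyb, hφa, hφb⟩ := φ.exists_eq_zero (y := y) hx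
  have hab : a ≤ b := hax.trans (hxy.trans hyb)
  have hsub := uIcc_subset_Ioi_zero ha hab
  have hgc : ContinuousOn (fun ρ => ‖hardyDeriv φ ρ‖ ^ 2) (uIcc a b) :=
    ((continuousOn_hardyDeriv φ.contDiff).mono hsub).norm.pow 2
  have e1 := intervalIntegral_norm_sq_le φ.memLp ha hab
  have e2 := intervalIntegral_norm_sq_le (φ.memLp_calogeroExpr m) ha hab
  have f1 : ‖(φ.memLp.toLp _ : L2)‖ ^ 2 ≤ M ^ 2 := pow_le_pow_left₀ (norm_nonneg _) h1 2
  have f2 : ‖((φ.memLp_calogeroExpr m).toLp _ : L2)‖ ^ 2 ≤ M ^ 2 :=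
    pow_le_pow_left₀ (norm_nonneg _) h2 2
  calc ∫ ρ in x..y, ‖hardyDeriv φ ρ‖ ^ 2 ≤ ∫ ρ in a..b, ‖hardyDeriv φ ρ‖ ^ 2 :=
        intervalIntegral.integral_mono_interval hax hxy hyb
          (ae_of_all _ fun ρ => by positivity) hgc.intervalIntegrable
    _ ≤ _ := integral_norm_hardyDeriv_sq_le m φ.contDiff ha hab hφa hφb
    _ = ((∫ ρ in a..b, ‖φ ρ‖ ^ 2) + ∫ ρ in a..b, ‖calogeroExpr m φ ρ‖ ^ 2) / 2 := by
        rw [intervalIntegral.integral_div, intervalIntegral.integral_add]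
        · exact (φ.continuous.norm.pow 2).intervalIntegrable _ _
        · exact ((φ.continuous_calogeroExpr m).norm.pow 2).intervalIntegrable _ _
    _ ≤ M ^ 2 := by linarith

theorem TestFn.norm_apply_le (h1 : ‖TestFn.toL2 φ‖ ≤ M) (h2 : ‖TestFn.calogero m φ‖ ≤ M)
    (x : ℝ) : ‖φ x‖ ≤ 2 * M := by
  have hM : 0 ≤ M := (norm_nonneg _).trans h1
  rcases le_or_gt x 0 with hx | hx
  · rw [φ.eq_zero_of_nonpos hx, norm_zero]
    positivity
  obtain ⟨a, b, -, -, hxb, -, hφb⟩ := φ.exists_eq_zero (y := x) hx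
  have hgc : ContinuousOn (fun ρ => ‖hardyDeriv φ ρ‖ ^ 2) (uIcc x b) :=
    ((continuousOn_hardyDeriv φ.contDiff).mono (uIcc_subset_Ioi_zero hx hxb)).norm.pow 2
  have e1 := intervalIntegral_norm_sq_le φ.memLp hx hxb
  have f1 : ‖(φ.memLp.toLp _ : L2)‖ ^ 2 ≤ M ^ 2 := pow_le_pow_left₀ (norm_nonneg _) h1 2
  have e2 := TestFn.integral_hardyDeriv_le h1 h2 hx hxb
  have e3 := norm_sq_le_integral φ.contDiff hx hxb hφb
  have hφc : IntervalIntegrable (fun ρ => ‖φ ρ‖ ^ 2) volume x b :=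
    (φ.continuous.norm.pow 2).intervalIntegrable _ _
  rw [intervalIntegral.integral_add hφc hgc.intervalIntegrable] at e3
  refine le_of_sq_le_sq ?_ (by positivity)
  -- The two integrals give `|φ x|² ≤ 2 M²`, which is weakened to `(2 M)²`.
  nlinarith [sq_nonneg M]

end Bounds

/-! ### Equicontinuity and pointwise convergent subsequences -/

/-- The unit balls of the graph norm are equicontinuous on `(0,∞)`. -/
theorem TestFn.exists_equicontinuous (m M : ℝ) {x η : ℝ} (hx : 0 < x) (hη : 0 < η) :
    ∃ t < x, 0 < t ∧ ∀ φ : TestFn, ‖TestFn.toL2 φ‖ ≤ M → ‖TestFn.calogero m φ‖ ≤ M →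
      ∀ y ∈ Ioo t x, ‖φ x - φ y‖ < η := by
  -- With this `ε` the energy term is at most `η/2`. The length bound `η/(2C)` below makes the other
  -- term less than `η/2`; the absolute value and `+ 1` keep `C` positive whatever the sign of `M`.
  set ε : ℝ := η / (M ^ 2 + 1) with hε
  have hε0 : 0 < ε := by positivity
  set C : ℝ := |1 / (2 * ε) + 1 / (2 * (x / 2)) * (2 * M)| + 1 with hC
  have hC0 : 0 < C := by positivity
  refine ⟨max (x / 2) (x - η / (2 * C)), max_lt (by linarith) ?_, lt_max_of_lt_left (by linarith),
    fun φ h1 h2 y hy => ?_⟩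
  · have : 0 < η / (2 * C) := by positivity
    linarith
  have hy1 : x / 2 < y := lt_of_le_of_lt (le_max_left _ _) hy.1
  have hy2 : x - y < η / (2 * C) := by
    linarith [lt_of_le_of_lt (le_max_right (x / 2) (x - η / (2 * C))) hy.1]
  have hyx : y ≤ x := hy.2.le
  have h3 := norm_sub_le_of_integral_hardyDeriv φ.contDiff (half_pos hx) hy1.le hyx hε0
    (TestFn.norm_apply_le h1 h2)
    (TestFn.integral_hardyDeriv_le h1 h2 ((half_pos hx).trans hy1) hyx)
  have h4 : ε / 2 * M ^ 2 ≤ η / 2 := by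
    have : ε * (M ^ 2 + 1) = η := div_mul_cancel₀ _ (by positivity)
    nlinarith
  have h5 : (x - y) * (1 / (2 * ε) + 1 / (2 * (x / 2)) * (2 * M)) ≤ (x - y) * C :=
    mul_le_mul_of_nonneg_left ((le_abs_self _).trans (by linarith)) (by linarith)
  have h6 : (x - y) * C < η / 2 := by
    rw [lt_div_iff₀ (by positivity)] at hy2
    linarith
  linarith

/-- The countable product of closed discs is compact and metrizable, hence sequentially compact;
this replaces a diagonal argument. -/
theorem exists_subseq_tendsto_rat {f : ℕ → ℝ → ℂ} {S : ℝ} (hS : ∀ n x, ‖f n x‖ ≤ S) :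
    ∃ k : ℕ → ℕ, StrictMono k ∧ ∀ q : ℚ, CauchySeq fun n => f (k n) q := by
  have hc : IsCompact (univ.pi fun _ : ℚ => Metric.closedBall (0 : ℂ) S) :=
    isCompact_univ_pi fun _ => isCompact_closedBall _ _
  obtain ⟨g, -, k, hk, hg⟩ := hc.isSeqCompact (x := fun n (q : ℚ) => f n q)
    fun n q _ => by simpa using hS n q
  exact ⟨k, hk, fun q => (tendsto_pi_nhds.1 hg q).cauchySeq⟩

/-- The Arzelà–Ascoli argument: convergence at the rationals spreads to every `x > 0` by
equicontinuity. Only pointwise limits are needed for dominated convergence. -/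
theorem TestFn.exists_subseq_tendsto {m M : ℝ} (φ : ℕ → TestFn)
    (h1 : ∀ n, ‖TestFn.toL2 (φ n)‖ ≤ M) (h2 : ∀ n, ‖TestFn.calogero m (φ n)‖ ≤ M) :
    ∃ (k : ℕ → ℕ) (F : ℝ → ℂ), StrictMono k ∧
      ∀ x, 0 < x → Tendsto (fun n => φ (k n) x) atTop (𝓝 (F x)) := by
  obtain ⟨k, hk, hq⟩ := exists_subseq_tendsto_rat (f := fun n => φ n)
    fun n x => TestFn.norm_apply_le (h1 n) (h2 n) x
  have hc : ∀ x : ℝ, ∃ z : ℂ, 0 < x → Tendsto (fun n => φ (k n) x) atTop (𝓝 z) := by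
    intro x
    by_cases hx : 0 < x
    swap
    · exact ⟨0, fun h => absurd h hx⟩
    suffices CauchySeq fun n => φ (k n) x by
      obtain ⟨z, hz⟩ := cauchySeq_tendsto_of_complete this
      exact ⟨z, fun _ => hz⟩
    rw [Metric.cauchySeq_iff]
    intro η hη
    obtain ⟨t, htx, ht0, ht⟩ := TestFn.exists_equicontinuous m M hx (show 0 < η / 3 by positivity)
    -- One-sided equicontinuity suffices, since a rational can be picked just to the left of `x`.
    obtain ⟨q, hq1, hq2⟩ := exists_rat_btwn htx
    obtain ⟨N, hN⟩ := Metric.cauchySeq_iff.1 (hq q) (η / 3) (by positivity)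
    refine ⟨N, fun i hi j hj => ?_⟩
    have a1 := ht _ (h1 (k i)) (h2 (k i)) q ⟨hq1, hq2⟩
    have a2 := ht _ (h1 (k j)) (h2 (k j)) q ⟨hq1, hq2⟩
    have a3 := hN i hi j hj
    rw [← dist_eq_norm] at a1 a2
    rw [dist_comm] at a2
    have a4 := dist_triangle4 (φ (k i) x) (φ (k i) q) (φ (k j) q) (φ (k j) x)
    linarith
  choose F hF using hc
  exact ⟨k, F, hk, hF⟩

/-! ### Dominated convergence and multiplication operators in `L²` -/

/-- The dominated convergence theorem in `L²(0,∞)`. -/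
theorem exists_tendsto_of_dominated {f : ℕ → L2} {F : ℝ → ℂ} {b : ℝ → ℝ}
    (hb : MemLp b 2 (volume.restrict (Ioi (0 : ℝ))))
    (hf : ∀ n, ∀ᵐ ρ ∂volume.restrict (Ioi (0 : ℝ)), ‖f n ρ‖ ≤ b ρ)
    (hF : ∀ᵐ ρ ∂volume.restrict (Ioi (0 : ℝ)), Tendsto (fun n => f n ρ) atTop (𝓝 (F ρ))) :
    ∃ g : L2, Tendsto f atTop (𝓝 g) := by
  have hbound : ∀ᵐ ρ ∂volume.restrict (Ioi (0 : ℝ)), ‖F ρ‖ ≤ b ρ := by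
    filter_upwards [ae_all_iff.2 hf, hF] with ρ h1 h2
    exact le_of_tendsto h2.norm (Eventually.of_forall h1)
  have hFm : AEStronglyMeasurable F (volume.restrict (Ioi (0 : ℝ))) :=
    aestronglyMeasurable_of_tendsto_ae atTop (fun n => Lp.aestronglyMeasurable (f n)) hF
  have hFL : MemLp F 2 (volume.restrict (Ioi (0 : ℝ))) := hb.mono' hFm hbound
  refine ⟨hFL.toLp F, ?_⟩
  rw [tendsto_iff_norm_sub_tendsto_zero]
  have h1 : Tendsto (fun n => ‖f n - hFL.toLp F‖ ^ 2) atTop (𝓝 0) := by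
    simp only [norm_sq_eq_integral]
    have h2 := tendsto_integral_of_dominated_convergence
      (F := fun n ρ => ‖(f n - hFL.toLp F : L2) ρ‖ ^ 2) (f := fun _ => (0 : ℝ))
      (fun ρ => 4 * b ρ ^ 2)
      (fun n => (Lp.aestronglyMeasurable (f n - hFL.toLp F)).norm.pow 2)
      (hb.integrable_sq.const_mul 4) ?_ ?_
    · simpa using h2
    · intro n
      filter_upwards [Lp.coeFn_sub (f n) (hFL.toLp F), hFL.coeFn_toLp, hf n, hbound]
        with ρ a1 a2 a3 a4
      rw [a1, Pi.sub_apply, a2, norm_pow, norm_norm]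
      have := norm_sub_le (f n ρ) (F ρ)
      calc ‖f n ρ - F ρ‖ ^ 2 ≤ (2 * b ρ) ^ 2 := by
            gcongr
            linarith
        _ = 4 * b ρ ^ 2 := by ring
    · filter_upwards [ae_all_iff.2 fun n => Lp.coeFn_sub (f n) (hFL.toLp F), hFL.coeFn_toLp, hF]
        with ρ a1 a2 a3
      simp only [a1, Pi.sub_apply, a2]
      have := ((a3.sub_const (F ρ)).norm.pow 2)
      simpa using this
  simpa using h1.sqrt

/-- Multiplication by a bounded function is a bounded operator. -/
theorem exists_mulCLM {w : ℝ → ℝ} {B : ℝ}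
    (hw : AEStronglyMeasurable w (volume.restrict (Ioi (0 : ℝ))))
    (hB : ∀ ρ, 0 < ρ → |w ρ| ≤ B) :
    ∃ K : L2 →L[ℂ] L2, ∀ u : L2, ∃ h : u ∈ (mulOp w).domain, K u = mulOp w ⟨u, h⟩ := by
  have hw' : AEStronglyMeasurable (fun ρ => (w ρ : ℂ)) (volume.restrict (Ioi (0 : ℝ))) :=
    Complex.continuous_ofReal.comp_aestronglyMeasurable hw
  have hle : ∀ u : L2, ∀ᵐ ρ ∂volume.restrict (Ioi (0 : ℝ)), ‖(w ρ : ℂ) * u ρ‖ ≤ B * ‖u ρ‖ := by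
    intro u
    filter_upwards [ae_restrict_mem measurableSet_Ioi] with ρ hρ
    rw [norm_mul, Complex.norm_real, Real.norm_eq_abs]
    gcongr
    exact hB ρ hρ
  have hdom : ∀ u : L2, u ∈ (mulOp w).domain := fun u =>
    (Lp.memLp u).of_le_mul (hw'.mul (Lp.aestronglyMeasurable u)) (hle u)
  let K₀ : L2 →ₗ[ℂ] L2 := (mulOp w).toFun.comp (LinearMap.id.codRestrict _ hdom)
  refine ⟨K₀.mkContinuous B fun u => ?_, fun u => ⟨hdom u, rfl⟩⟩
  refine Lp.norm_le_mul_norm_of_ae_le_mul ?_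
  filter_upwards [MemLp.coeFn_toLp (hdom u), hle u] with ρ h1 h2
  rw [← h1] at h2
  exact h2

theorem coeFn_mulOp (w : ℝ → ℝ) (u : (mulOp w).domain) :
    (mulOp w u : ℝ → ℂ) =ᵐ[volume.restrict (Ioi (0 : ℝ))] fun ρ => (w ρ : ℂ) * (u : L2) ρ :=
  MemLp.coeFn_toLp u.2

/-! ### Compactness of multiplication on the graphs -/

/-- Multiplication by a square integrable function is compact with respect to the graph norm of
`preH₀`. -/
theorem seqCompactOn_graph_preH₀ (m : ℝ) {w : ℝ → ℝ}
    (hw : MemLp w 2 (volume.restrict (Ioi (0 : ℝ)))) {K : L2 →L[ℂ] L2}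
    (hK : ∀ u : L2, ∃ h : u ∈ (mulOp w).domain, K u = mulOp w ⟨u, h⟩) :
    SeqCompactOn (K.comp (ContinuousLinearMap.fst ℂ L2 L2)) (preH₀ m).graph := by
  intro u hu M hM
  have h1 : ∀ n, ∃ φ : TestFn, TestFn.toL2 φ = (u n).1 ∧ TestFn.calogero m φ = (u n).2 := by
    intro n
    obtain ⟨⟨_, φ, rfl⟩, hy1, hy2⟩ := (LinearPMap.mem_graph_iff _).1 (hu n)
    exact ⟨φ, hy1, (preH₀_apply m φ).symm.trans hy2⟩
  choose φ hφ1 hφ2 using h1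
  have b1 : ∀ n, ‖TestFn.toL2 (φ n)‖ ≤ M := fun n => by
    rw [hφ1]
    exact (norm_fst_le _).trans (hM n)
  have b2 : ∀ n, ‖TestFn.calogero m (φ n)‖ ≤ M := fun n => by
    rw [hφ2]
    exact (norm_snd_le _).trans (hM n)
  obtain ⟨k, F, hk, hF⟩ := TestFn.exists_subseq_tendsto φ b1 b2
  have hKφ : ∀ n, (K (u n).1 : ℝ → ℂ) =ᵐ[volume.restrict (Ioi (0 : ℝ))]
      fun ρ => (w ρ : ℂ) * φ n ρ := fun n => by
    obtain ⟨h, e⟩ := hK (u n).1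
    rw [e]
    filter_upwards [coeFn_mulOp w ⟨_, h⟩, (φ n).memLp.coeFn_toLp] with ρ a1 a2
    rw [a1]
    rw [← hφ1]
    exact congrArg _ a2
  -- The dominating function is `2 M |w|`: the uniform bound on test functions times the square
  -- integrable multiplier.
  obtain ⟨g, hg⟩ := exists_tendsto_of_dominated (f := fun n => K (u (k n)).1)
    (F := fun ρ => (w ρ : ℂ) * F ρ) (hw.norm.const_mul (2 * M)) (fun n => by
      filter_upwards [hKφ (k n)] with ρ a1
      rw [a1, norm_mul, Complex.norm_real, mul_comm]
      exact mul_le_mul_of_nonneg_right (TestFn.norm_apply_le (b1 _) (b2 _) ρ) (norm_nonneg _)) (by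
      filter_upwards [ae_all_iff.2 fun n => hKφ (k n), ae_restrict_mem measurableSet_Ioi]
        with ρ a1 hρ
      simp only [a1]
      exact (hF ρ hρ).const_mul _)
  exact ⟨g, k, hk, hg⟩

/-- Up to one dimension, the graph of `H₀` is the closure of the graph of `preH₀`. -/
theorem exists_graph_H₀_le (m : ℝ) (hm : 0 ≤ m) (ζ : ℝ → ℝ) (hζ : IsCutoff ζ) :
    ∃ e : L2 × L2,
      (H₀ m hm ζ hζ).graph ≤ (preH₀ m).graph.topologicalClosure ⊔ Submodule.span ℂ {e} := by
  have hle : (H₀ m hm ζ hζ) ≤ (preH₀ m).adjoint := LinearPMap.domRestrict_le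
  have hζd : (memLp_zetaFn hm hζ).toLp (zetaFn m ζ) ∈ (H₀ m hm ζ hζ).domain := by
    rw [H₀_domain]
    exact Submodule.mem_sup_right (Submodule.mem_span_singleton_self _)
  set e : L2 × L2 := (_, H₀ m hm ζ hζ ⟨_, hζd⟩) with he_def
  have he : e ∈ (preH₀ m).adjoint.graph :=
    LinearPMap.le_graph_of_le hle (LinearPMap.mem_graph _ _)
  refine ⟨e, ?_⟩
  rw [(preH₀_isClosable m).graph_closure_eq_closure_graph]
  rintro ⟨v, v'⟩ hv
  have hv1 : v ∈ domH₀ m hm ζ hζ := by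
    rw [← H₀_domain]
    exact LinearPMap.mem_domain_of_mem_graph hv
  obtain ⟨a, ha, b, hb, rfl⟩ := Submodule.mem_sup.1 hv1
  obtain ⟨c, rfl⟩ := Submodule.mem_span_singleton.1 hb
  have ha' : (a, (preH₀ m).closure ⟨a, ha⟩) ∈ (preH₀ m).closure.graph :=
    LinearPMap.mem_graph _ ⟨a, ha⟩
  have h1 := (preH₀ m).adjoint.graph.add_mem
    (LinearPMap.le_graph_of_le (closure_le_adjoint m) ha')
    ((preH₀ m).adjoint.graph.smul_mem c he)
  -- Both pairs lie in the graph of the adjoint and share a first component, so their second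
  -- components agree.
  have h2 := LinearPMap.mem_graph_snd_inj _ (LinearPMap.le_graph_of_le hle hv) h1 rfl
  have h3 : (a + c • (memLp_zetaFn hm hζ).toLp (zetaFn m ζ), v') =
      (a, (preH₀ m).closure ⟨a, ha⟩) + c • e := Prod.ext rfl h2
  rw [h3]
  exact Submodule.add_mem_sup ha' (Submodule.smul_mem _ c (Submodule.mem_span_singleton_self e))

theorem seqCompactOn_graph_H₀ (m : ℝ) (hm : 0 ≤ m) (ζ : ℝ → ℝ) (hζ : IsCutoff ζ) {w : ℝ → ℝ}
    (hw : MemLp w 2 (volume.restrict (Ioi (0 : ℝ)))) {K : L2 →L[ℂ] L2}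
    (hK : ∀ u : L2, ∃ h : u ∈ (mulOp w).domain, K u = mulOp w ⟨u, h⟩) :
    SeqCompactOn (K.comp (ContinuousLinearMap.fst ℂ L2 L2)) (H₀ m hm ζ hζ).graph := by
  obtain ⟨e, he⟩ := exists_graph_H₀_le m hm ζ hζ
  intro u hu
  exact (seqCompactOn_graph_preH₀ m hw hK).topologicalClosure.sup_span_singleton
    (Submodule.isClosed_topologicalClosure _) e u fun n => he (hu n)

/-! ### The perturbation `W - C₀` and the main theorem -/

theorem PotentialAssumption.continuousOn_sub {V W : ℝ → ℝ} {c₂ C₀ : ℝ}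
    (hV : PotentialAssumption V W c₂ C₀) : ContinuousOn (fun ρ => W ρ - C₀) (Ici 0) :=
  hV.continuous_W.sub continuousOn_const

/-- Continuity up to `0` handles `[0,1]`, and the integrability assumption handles `[1,∞)`. -/
theorem PotentialAssumption.memLp_sub {V W : ℝ → ℝ} {c₂ C₀ : ℝ}
    (hV : PotentialAssumption V W c₂ C₀) :
    MemLp (fun ρ => W ρ - C₀) 2 (volume.restrict (Ioi (0 : ℝ))) := by
  have hc := hV.continuousOn_sub
  rw [memLp_two_iff_integrable_sq
    ((hc.mono Ioi_subset_Ici_self).aestronglyMeasurable measurableSet_Ioi)]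
  have h1 : IntegrableOn (fun ρ => (W ρ - C₀) ^ 2) (Icc 0 1) :=
    ((hc.pow 2).mono Icc_subset_Ici_self).integrableOn_compact isCompact_Icc
  refine (h1.union hV.sq_integrable).mono_set fun ρ hρ => ?_
  rcases le_total ρ 1 with h | h
  · exact Or.inl ⟨le_of_lt hρ, h⟩
  · exact Or.inr h

end HalfLine

end

theorem lemma2 (V W : ℝ → ℝ) (c₂ C₀ m : ℝ) (hV : HalfLine.PotentialAssumption V W c₂ C₀)
    (hm : 0 ≤ m) (hc₂ : c₂ = m ^ 2 - 1 / 4) (ζ : ℝ → ℝ) (hζ : HalfLine.IsCutoff ζ) :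
    HalfLine.IsRelativelyCompact (HalfLine.mulOp fun ρ => W ρ - C₀) (HalfLine.H₀ m hm ζ hζ) ∧
      ∀ (z : ℂ) (R : HalfLine.L2 →L[ℂ] HalfLine.L2),
        HalfLine.IsResolventAt (HalfLine.H₀ m hm ζ hζ) z R →
          ∃ T : HalfLine.L2 →L[ℂ] HalfLine.L2, IsCompactOperator T ∧
            ∀ f : HalfLine.L2, ∃ h : R f ∈ (HalfLine.mulOp fun ρ => W ρ - C₀).domain,
              T f = HalfLine.mulOp (fun ρ => W ρ - C₀) ⟨R f, h⟩ := by
  obtain ⟨B, hB⟩ := hV.bounded_W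
  have hw := hV.memLp_sub
  obtain ⟨K, hK⟩ := HalfLine.exists_mulCLM (B := B + |C₀|) hw.1
    fun ρ hρ => (abs_sub _ _).trans (by gcongr; exact hB ρ hρ.le)
  have hcomp := HalfLine.seqCompactOn_graph_H₀ m hm ζ hζ hw hK
  refine ⟨⟨fun u _ => (hK u).1, fun u ⟨M, hM⟩ => ?_⟩, fun z R hR => ⟨K.comp R, ?_, fun f => hK _⟩⟩
  · obtain ⟨g, k, hk, hg⟩ := hcomp (fun n => ((u n : HalfLine.L2), HalfLine.H₀ m hm ζ hζ (u n)))
      (fun n => LinearPMap.mem_graph _ _) M fun n => max_le (hM n).1 (hM n).2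
    exact ⟨g, k, hk, hg.congr fun n => (hK _).2⟩
  · refine isCompactOperator_of_seq _ fun f _ M hM => ?_
    have hd : ∀ n, R (f n) ∈ (HalfLine.H₀ m hm ζ hζ).domain := fun n => (hR.1 (f n)).1
    have hRM : ∀ n, ‖R (f n)‖ ≤ ‖R‖ * M := fun n => R.le_opNorm_of_le (hM n)
    -- Since `H₀ R f = f + z R f`, bounded `f n` give a bounded sequence in the graph of `H₀`, whose
    -- norm is the maximum of the two components.
    refine hcomp (fun n => (R (f n), HalfLine.H₀ m hm ζ hζ ⟨R (f n), hd n⟩))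
      (fun n => LinearPMap.mem_graph _ ⟨_, hd n⟩) (max (‖R‖ * M) (M + ‖z‖ * (‖R‖ * M)))
      fun n => max_le_max (hRM n) ?_
    rw [eq_add_of_sub_eq (hR.1 (f n)).2]
    refine (norm_add_le _ _).trans (add_le_add (hM n) ?_)
    rw [norm_smul]
    gcongr
    exact hRM n
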